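/- Let $\mathbb S_n$ be the space of real symmetric $n\times n$ matrices with the Frobenius norm, $K_n\subseteq\mathbb S_n$ the cone of positive semidefinite matrices, $L\subseteq\mathbb S_n$ a linear subspace and $c\in\mathbb S_n$. The problem $(K_n,L,c)$ is called weakly infeasible if $(L+c)\cap K_n=\emptyset$ and $\operatorname{dist}(K_n,L+c)=\inf\{\|x-y\| : x\in K_n,\ y\in L+c\}=0$. For an $r\times r$ matrix $X$ and $0\le k\le r$, let $\overline\pi_k(X)$ be its lower right $(r-k)\times(r-k)$ principal submatrix. Procedure FP with input $(K_n,L,c)$: start with $P=I_n$, $\widetilde L=L$, $\widetilde c=c$ and no directions. In iteration $i\ge1$, put $N_{i-1}=k_1+\dots+k_{i-1}$. If $\widetilde L^\perp$ contains a positive definite matrix, stop. Otherwise choose a positive semidefinite $\widetilde A_i\in\widetilde L$ with $\operatorname{tr}\widetilde A_i=1$, put $k_i=\operatorname{rank}\widetilde A_i$, and choose a nonsingular $\widetilde P$ with $\widetilde P^T\widetilde A_i\widetilde P=\begin{pmatrix}\widehat A_i&0\\0&0\end{pmatrix}$, $\widehat A_i$ positive definite of order $k_i$. Put $M=\begin{pmatrix}I_{N_{i-1}}&0\\0&\widetilde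 P\end{pmatrix}$, replace $P$ by $PM$ and each earlier $A_j$ by $M^TA_jM$, let $A_i$ be any matrix in $P^TLP$ with $\overline\pi_{N_{i-1}}(A_i)=\widetilde P^T\widetilde A_i\widetilde P$, and replace $\widetilde L$ and $\widetilde c$ by $\overline\pi_{k_i}(\widetilde P^T\widetilde L\widetilde P)$ and $\overline\pi_{k_i}(\widetilde P^T\widetilde c\widetilde P)$. The output is $P$, $k_1,\dots,k_m$ and the (maximal) hyper feasible partition $A_1,\dots,A_m\in P^TLP$. **Theorem.** Suppose $(K_n,L,c)$ is weakly infeasible. 1. There are a linear subspace $L'$ of dimension at most $n-1$ and a matrix $c'$ such that $L'+c'\subseteq L+c$ and $(K_n,L',c')$ is weakly infeasible. 2. Procedure FP has an output for the input $(K_n,L,c)$. For every output $P$, $k_1,\dots,k_m$, $A_1,\dots,A_m$, with $N_m=k_1+\dots+k_m$ and $D_i=P^{-T}A_iP^{-1}$: one has $1\le m\le n-1$; there is $c'\in L+c$ such that $\overline\pi_{N_m}(P^Tc'P)$ is positive semidefinite; and for every such $c'$ the space $L'=\operatorname{span}\{D_1,\dots,D_m\}$ has dimension at most $n-1$, $L'+c'\subseteq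 L+c$, $(K_n,L',c')$ is weakly infeasible, and for every $\varepsilon>0$ there are $\alpha_1,\dots,\alpha_m>0$ with $\operatorname{dist}(c'+\alpha_1D_1+\dots+\alpha_mD_m,\,K_n)<\varepsilon$. -/

import Mathlib

namespace SDFP

section Basic

variable {ι κ : Type*} [Fintype ι] [Fintype κ]

/-- The cone of positive semidefinite real symmetric matrices. -/
def psdCone (ι : Type*) [Fintype ι] : Set (Matrix ι ι ℝ) := {X | X.PosSemidef}

/-- The affine set `L + c`. -/
def affineSet (L : Submodule ℝ (Matrix ι ι ℝ)) (c : Matrix ι ι ℝ) : Set (Matrix ι ι ℝ) :=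
  {x | ∃ l ∈ L, x = l + c}

open scoped Matrix.Norms.Frobenius in
/-- The distance `inf ‖x - y‖` between two (nonempty) sets of matrices, in the Frobenius norm. -/
noncomputable def setDist (C D : Set (Matrix ι ι ℝ)) : ℝ :=
  sInf {r | ∃ x ∈ C, ∃ y ∈ D, r = ‖x - y‖}

/-- `(K, L, c)` is weakly infeasible: `L + c` misses the positive semidefinite cone, but its
distance to the cone is zero. -/
def WeaklyInfeasible (L : Submodule ℝ (Matrix ι ι ℝ)) (c : Matrix ι ι ℝ) : Prop :=
  affineSet L c ∩ psdCone ι = ∅ ∧ setDist (psdCone ι) (affineSet L c) = 0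

/-- The congruence `X ↦ Qᵀ X Q`. -/
def congruence (Q : Matrix ι ι ℝ) : Matrix ι ι ℝ →ₗ[ℝ] Matrix ι ι ℝ where
  toFun X := Q.transpose * X * Q
  map_add' X Y := by rw [mul_add, add_mul]
  map_smul' r X := by simp

/-- The submatrix of `X` with rows and columns selected by `f`. -/
def principal {ι κ : Type*} (f : κ → ι) : Matrix ι ι ℝ →ₗ[ℝ] Matrix κ κ ℝ where
  toFun X := X.submatrix f f
  map_add' _ _ := rfl
  map_smul' _ _ := rfl

end Basic

/-- The indices of the lower right `(n - N) × (n - N)` block of an `n × n` matrix. -/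
abbrev Tail (n N : ℕ) : Type := {i : Fin n // N ≤ i.val}

/-- `lowerRight N X` is the lower right `(n - N) × (n - N)` block of the `n × n` matrix `X`. -/
def lowerRight {n : ℕ} (N : ℕ) :
    Matrix (Fin n) (Fin n) ℝ →ₗ[ℝ] Matrix (Tail n N) (Tail n N) ℝ :=
  principal Subtype.val

/-- Delete from a matrix indexed by `Tail n N` the rows and columns with index below `N'`. -/
def lowerRightOfTail {n N N' : ℕ} (h : N ≤ N') :
    Matrix (Tail n N) (Tail n N) ℝ →ₗ[ℝ] Matrix (Tail n N') (Tail n N') ℝ :=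
  principal fun i => ⟨i.val, h.trans i.property⟩

/-- The block diagonal `n × n` matrix with blocks `I_N` and `Q`. -/
def extendByOne {n N : ℕ} (Q : Matrix (Tail n N) (Tail n N) ℝ) : Matrix (Fin n) (Fin n) ℝ :=
  Matrix.of fun i j =>
    if h : N ≤ i.val ∧ N ≤ j.val then Q ⟨i, h.1⟩ ⟨j, h.2⟩ else if i = j then 1 else 0

/-- `Y` has the block form `(Â 0; 0 0)` with `Â` positive definite of order `k`. -/
def IsPosDefCorner {n N : ℕ} (k : ℕ) (Y : Matrix (Tail n N) (Tail n N) ℝ) : Prop :=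
  (principal (fun i : {i : Tail n N // i.val.val < N + k} => i.val) Y).PosDef ∧
    ∀ i j : Tail n N, N + k ≤ i.val.val ∨ N + k ≤ j.val.val → Y i j = 0

/-- The variables of the forward procedure, between two iterations:
the accumulated matrix `P`, the ranks `k₁, …, kₘ` and directions `A₁, …, Aₘ` found so far, and the
current subproblem `(K, Lt, ct)`, where `K` is the cone of positive semidefinite matrices of order
`n - (k₁ + ⋯ + kₘ)`. -/
structure FPState (n : ℕ) where
  P : Matrix (Fin n) (Fin n) ℝ
  ks : List ℕ
  A : List (Matrix (Fin n) (Fin n) ℝ)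
  Lt : Submodule ℝ (Matrix (Tail n ks.sum) (Tail n ks.sum) ℝ)
  ct : Matrix (Tail n ks.sum) (Tail n ks.sum) ℝ

namespace FPState

variable {n : ℕ}

/-- The initial values of the variables. -/
def init (L : Submodule ℝ (Matrix (Fin n) (Fin n) ℝ)) (c : Matrix (Fin n) (Fin n) ℝ) :
    FPState n where
  P := 1
  ks := []
  A := []
  Lt := L.map (lowerRight _)
  ct := lowerRight _ c

theorem sum_le_sum_append (ks : List ℕ) (k : ℕ) : ks.sum ≤ (ks ++ [k]).sum := by
  simp

/-- The update at the end of an iteration in which the congruence `Pt`, the rank `k` and the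
new direction `A'` have been chosen. -/
def next (s : FPState n) (Pt : Matrix (Tail n s.ks.sum) (Tail n s.ks.sum) ℝ) (k : ℕ)
    (A' : Matrix (Fin n) (Fin n) ℝ) : FPState n where
  P := s.P * extendByOne Pt
  ks := s.ks ++ [k]
  A := s.A.map (congruence (extendByOne Pt)) ++ [A']
  Lt := (s.Lt.map (congruence Pt)).map (lowerRightOfTail (sum_le_sum_append s.ks k))
  ct := lowerRightOfTail (sum_le_sum_append s.ks k) (congruence Pt s.ct)

/-- The procedure stops: the orthogonal complement of `Lt` contains a positive definite matrix `B`.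
(The normalization `tr B = 1` can be achieved by scaling unless the block is empty; it is left out
so that the procedure stops also at the empty block.) -/
def Stops (s : FPState n) : Prop :=
  ∃ B : Matrix (Tail n s.ks.sum) (Tail n s.ks.sum) ℝ,
    B.PosDef ∧ ∀ X ∈ s.Lt, (B * X).trace = 0

/-- The directions of the state, transformed back from `Pᵀ L P` to `L`. -/
noncomputable def directions (s : FPState n) : List (Matrix (Fin n) (Fin n) ℝ) :=
  s.A.map (congruence s.P⁻¹)

end FPState

/-- The states which the forward procedure can reach from the input `(K_n, L, c)`. In each iteration
the procedure is free to choose a positive semidefinite `At` of trace one in the current subspace,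
a nonsingular `Pt` with `Ptᵀ At Pt = (Â 0; 0 0)`, `Â` positive definite of order `rank At`, and a
matrix `A'` in `Pᵀ L P` (for the updated `P`) whose lower right block is `Ptᵀ At Pt`. -/
inductive FPReachable {n : ℕ} (L : Submodule ℝ (Matrix (Fin n) (Fin n) ℝ))
    (c : Matrix (Fin n) (Fin n) ℝ) : FPState n → Prop
  | init : FPReachable L c (FPState.init L c)
  | step (s : FPState n) (hs : FPReachable L c s)
      (At : Matrix (Tail n s.ks.sum) (Tail n s.ks.sum) ℝ)
      (hAt : At ∈ s.Lt) (hpsd : At.PosSemidef) (htr : At.trace = 1)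
      (Pt : Matrix (Tail n s.ks.sum) (Tail n s.ks.sum) ℝ) (hPt : IsUnit Pt)
      (hcorner : IsPosDefCorner At.rank (congruence Pt At))
      (A' : Matrix (Fin n) (Fin n) ℝ)
      (hA' : A' ∈ L.map (congruence (s.P * extendByOne Pt)))
      (hblock : lowerRight s.ks.sum A' = congruence Pt At) :
      FPReachable L c (s.next Pt At.rank A')

/-- `s` holds a possible output of the forward procedure on the input `(K_n, L, c)`. The list `s.A`
is then a maximal hyper feasible partition. -/
def IsFPOutput {n : ℕ} (L : Submodule ℝ (Matrix (Fin n) (Fin n) ℝ))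
    (c : Matrix (Fin n) (Fin n) ℝ) (s : FPState n) : Prop :=
  FPReachable L c s ∧ s.Stops

/-- The linear span of the directions `A₁, …, Aₘ`, transformed back to `L`. -/
noncomputable def FPState.directionSpan {n : ℕ} (s : FPState n) :
    Submodule ℝ (Matrix (Fin n) (Fin n) ℝ) :=
  Submodule.span ℝ {D | D ∈ s.directions}

end SDFP

namespace SDFP

open Matrix Filter Topology

section Semidefinite

variable {ι : Type*} [Fintype ι]

theorem continuous_quadraticForm (X : Matrix ι ι ℝ) :
    Continuous fun x : ι → ℝ => x ⬝ᵥ (X *ᵥ x) := by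
  fun_prop

/-- Finsler's lemma: if `X` is positive on the kernel of the positive semidefinite `A`, then
`X + α A` is positive definite for some `α > 0`. -/
theorem exists_posDef_add_smul {X A : Matrix ι ι ℝ} (hX : X.IsHermitian) (hA : A.PosSemidef)
    (h : ∀ x : ι → ℝ, x ≠ 0 → x ⬝ᵥ (A *ᵥ x) = 0 → 0 < x ⬝ᵥ (X *ᵥ x)) :
    ∃ α : ℝ, 0 < α ∧ (X + α • A).PosDef := by
  have hAn : ∀ x : ι → ℝ, 0 ≤ x ⬝ᵥ (A *ᵥ x) := fun x => by
    simpa using hA.dotProduct_mulVec_nonneg x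
  set S : Set (ι → ℝ) := Metric.sphere 0 1 ∩ {x | x ⬝ᵥ (X *ᵥ x) ≤ 0} with hS
  have hSc : IsCompact S := (isCompact_sphere 0 1).inter_right
    (isClosed_le (continuous_quadraticForm X) continuous_const)
  have hne : ∀ x ∈ Metric.sphere (0 : ι → ℝ) 1, x ≠ 0 := by
    rintro x hx rfl
    simp at hx
  obtain ⟨α, hα, hpos⟩ : ∃ α : ℝ, 0 < α ∧ ∀ x ∈ Metric.sphere (0 : ι → ℝ) 1,
      0 < x ⬝ᵥ (X *ᵥ x) + α * (x ⬝ᵥ (A *ᵥ x)) := by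
    rcases S.eq_empty_or_nonempty with hE | hN
    · refine ⟨1, one_pos, fun x hx => ?_⟩
      have : ¬ x ⬝ᵥ (X *ᵥ x) ≤ 0 := fun hle => by
        have : x ∈ S := ⟨hx, hle⟩
        simp [hE] at this
      have := hAn x
      linarith
    · obtain ⟨a, ha, hamin⟩ := hSc.exists_isMinOn hN (continuous_quadraticForm A).continuousOn
      obtain ⟨b, hb, hbmin⟩ := hSc.exists_isMinOn hN (continuous_quadraticForm X).continuousOn
      have hμ : 0 < a ⬝ᵥ (A *ᵥ a) := by
        refine lt_of_le_of_ne (hAn a) fun h0 => ?_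
        exact absurd (h a (hne a ha.1) h0.symm) (not_lt.2 ha.2)
      have hM : b ⬝ᵥ (X *ᵥ b) ≤ 0 := hb.2
      set μ := a ⬝ᵥ (A *ᵥ a)
      set M := b ⬝ᵥ (X *ᵥ b)
      have hα : 0 < (1 - M) / μ := div_pos (by linarith) hμ
      refine ⟨(1 - M) / μ, hα, fun x hx => ?_⟩
      by_cases hle : x ⬝ᵥ (X *ᵥ x) ≤ 0
      · have h1 : μ ≤ x ⬝ᵥ (A *ᵥ x) := hamin (⟨hx, hle⟩ : x ∈ S)
        have h2 : M ≤ x ⬝ᵥ (X *ᵥ x) := hbmin (⟨hx, hle⟩ : x ∈ S)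
        have h3 := mul_le_mul_of_nonneg_left h1 hα.le
        rw [div_mul_cancel₀ _ hμ.ne'] at h3
        linarith
      · have := mul_nonneg hα.le (hAn x)
        linarith
  refine ⟨α, hα, .of_dotProduct_mulVec_pos (hX.add (hA.smul hα.le).isHermitian) fun x hx => ?_⟩
  have hn : 0 < ‖x‖ := norm_pos_iff.2 hx
  have := hpos (‖x‖⁻¹ • x) (by simp [norm_smul, hn.ne'])
  simp only [mulVec_smul, smul_dotProduct, dotProduct_smul, smul_eq_mul] at this
  have h2 := mul_pos (mul_pos hn hn) this
  have : star x ⬝ᵥ ((X + α • A) *ᵥ x) = ‖x‖ * ‖x‖ * (‖x‖⁻¹ * (‖x‖⁻¹ * (x ⬝ᵥ (X *ᵥ x))) +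
      α * (‖x‖⁻¹ * (‖x‖⁻¹ * (x ⬝ᵥ (A *ᵥ x))))) := by
    simp only [add_mulVec, smul_mulVec, dotProduct_add, dotProduct_smul, star_trivial, smul_eq_mul]
    field_simp
  rw [this]
  exact h2

theorem trace_mul_nonneg [DecidableEq ι] {A B : Matrix ι ι ℝ} (hA : A.PosSemidef)
    (hB : B.PosSemidef) : 0 ≤ (A * B).trace := by
  have h := hB.isHermitian.spectral_theorem
  rw [Unitary.conjStarAlgAut_apply] at h
  rw [h, ← mul_assoc, trace_mul_comm, ← mul_assoc, ← mul_assoc, trace]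
  refine Finset.sum_nonneg fun i _ => ?_
  rw [diag_apply, mul_diagonal]
  exact mul_nonneg (hA.conjTranspose_mul_mul_same _).diag_nonneg (hB.eigenvalues_nonneg i)

theorem trace_mul_vecMulVec (B : Matrix ι ι ℝ) (x : ι → ℝ) :
    (B * vecMulVec x x).trace = x ⬝ᵥ (B *ᵥ x) := by
  rw [mul_vecMulVec, trace_vecMulVec, dotProduct_comm]

theorem isClosed_psdCone : IsClosed (psdCone ι) := by
  have : psdCone ι = {X : Matrix ι ι ℝ | Xᴴ = X} ∩
      ⋂ x : ι → ℝ, {X | 0 ≤ star x ⬝ᵥ (X *ᵥ x)} := by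
    ext X
    simp [psdCone, posSemidef_iff_dotProduct_mulVec, IsHermitian]
  rw [this]
  refine (isClosed_eq (by fun_prop) continuous_id).inter (isClosed_iInter fun x => ?_)
  exact isClosed_le continuous_const (by fun_prop)

theorem abs_apply_le_trace {X : Matrix ι ι ℝ} (hX : X.PosSemidef) (i j : ι) :
    |X i j| ≤ X.trace := by
  classical
  have hd : ∀ k, X k k ≤ X.trace := fun k =>
    Finset.single_le_sum (f := fun k => X k k) (fun k _ => hX.diag_nonneg) (Finset.mem_univ k)
  have hs : X j i = X i j := by simpa using hX.isHermitian.apply i j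
  have h (t : ℝ) := hX.dotProduct_mulVec_nonneg (Pi.single i 1 + t • Pi.single j 1)
  simp only [star_trivial, mulVec_add, mulVec_smul, mulVec_single, dotProduct_add, add_dotProduct,
    smul_dotProduct, dotProduct_smul, single_dotProduct, smul_eq_mul, MulOpposite.op_one, one_smul,
    one_mul, col_apply, hs] at h
  have h1 := h 1
  have h2 := h (-1)
  have := hd i
  have := hd j
  rw [abs_le]
  constructor <;> linarith

theorem isCompact_psd_trace_le (R : ℝ) :
    IsCompact {X : Matrix ι ι ℝ | X.PosSemidef ∧ X.trace ≤ R} := by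
  have hK : IsCompact (Set.univ.pi fun _ : ι => Set.univ.pi fun _ : ι => Set.Icc (-R) R) :=
    isCompact_univ_pi fun _ => isCompact_univ_pi fun _ => isCompact_Icc
  refine hK.of_isClosed_subset
    (isClosed_psdCone.inter (isClosed_le (f := fun X : Matrix ι ι ℝ => X.trace)
      (by fun_prop) continuous_const)) ?_
  rintro X ⟨hX, hR⟩ i - j -
  exact abs_le.1 ((abs_apply_le_trace hX i j).trans hR)

/-- If the orthogonal complement of `L` contains a positive definite matrix, then an affine set
`L + c` at distance zero from the positive semidefinite cone meets the cone. -/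
theorem exists_posSemidef_of_tendsto {L : Submodule ℝ (Matrix ι ι ℝ)} {c B : Matrix ι ι ℝ}
    (hB : B.PosDef) (hBL : ∀ X ∈ L, (B * X).trace = 0) {x y : ℕ → Matrix ι ι ℝ}
    (hx : ∀ k, (x k).PosSemidef) (hy : ∀ k, y k ∈ affineSet L c)
    (hxy : Tendsto (fun k => x k - y k) atTop (𝓝 0)) :
    ∃ z ∈ affineSet L c, z.PosSemidef := by
  classical
  obtain ⟨α, hα, hpd⟩ := exists_posDef_add_smul (X := (-1 : Matrix ι ι ℝ)) (A := B)
    isHermitian_one.neg hB.posSemidef fun v hv h0 => by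
      have := hB.dotProduct_mulVec_pos hv
      simp only [star_trivial] at this
      exact absurd h0 this.ne'
  have hyB : ∀ k, (B * y k).trace = (B * c).trace := fun k => by
    obtain ⟨l, hl, h⟩ := hy k
    rw [h, mul_add, trace_add, hBL l hl, zero_add]
  have hlim : Tendsto (fun k => (B * (x k - y k)).trace) atTop (𝓝 0) := by
    have hc : Continuous fun X : Matrix ι ι ℝ => (B * X).trace := by fun_prop
    simpa [Function.comp_def] using (hc.tendsto 0).comp hxy
  obtain ⟨R, hR⟩ := hlim.bddAbove_range
  have hbound : ∀ k, x k ∈ {X : Matrix ι ι ℝ | X.PosSemidef ∧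
      X.trace ≤ α * (R + (B * c).trace)} := fun k => by
    refine ⟨hx k, ?_⟩
    have h1 := trace_mul_nonneg hpd.posSemidef (hx k)
    have h2 : (B * (x k - y k)).trace ≤ R := hR ⟨k, rfl⟩
    rw [mul_sub, trace_sub, hyB] at h2
    simp only [add_mul, neg_mul, one_mul, smul_mul, trace_add, trace_neg, trace_smul,
      smul_eq_mul] at h1
    have h3 : α * (B * x k).trace ≤ α * (R + (B * c).trace) :=
      mul_le_mul_of_nonneg_left (by linarith) hα.le
    linarith
  have : FirstCountableTopology (Matrix ι ι ℝ) :=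
    inferInstanceAs (FirstCountableTopology (ι → ι → ℝ))
  obtain ⟨z, hz, φ, hφ, hlimz⟩ := (isCompact_psd_trace_le _).tendsto_subseq hbound
  refine ⟨z, ⟨z - c, ?_, by simp⟩, hz.1⟩
  have hLc : IsClosed (L : Set (Matrix ι ι ℝ)) := L.closed_of_finiteDimensional
  have hlimy : Tendsto (fun k => y (φ k) - c) atTop (𝓝 (z - c)) := by
    have := (hlimz.sub (hxy.comp hφ.tendsto_atTop)).sub_const c
    simpa using this
  refine hLc.mem_of_tendsto hlimy (Eventually.of_forall fun k => ?_)
  obtain ⟨l, hl, h⟩ := hy (φ k)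
  simpa [h] using hl

theorem exists_eq_trace_mul (f : Matrix ι ι ℝ →ₗ[ℝ] ℝ) :
    ∃ C : Matrix ι ι ℝ, ∀ X, f X = (C * X).trace := by
  classical
  refine ⟨of fun i j => f (single j i 1), fun X => ?_⟩
  conv_lhs => rw [matrix_eq_sum_single X]
  simp only [map_sum, trace, diag_apply, mul_apply, of_apply]
  rw [Finset.sum_comm]
  refine Finset.sum_congr rfl fun i _ => Finset.sum_congr rfl fun j _ => ?_
  rw [← mul_one (X j i), ← smul_eq_mul, ← smul_single, map_smul, smul_eq_mul, smul_eq_mul, mul_one,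
    mul_comm]

/-- Theorem of the alternative: either the orthogonal complement of `L` contains a positive definite
matrix, or `L` contains a positive semidefinite matrix of trace one. -/
theorem exists_posDef_orthogonal_or_exists_posSemidef {L : Submodule ℝ (Matrix ι ι ℝ)}
    (hL : ∀ X ∈ L, X.IsSymm) :
    (∃ B : Matrix ι ι ℝ, B.PosDef ∧ ∀ X ∈ L, (B * X).trace = 0) ∨
      ∃ A ∈ L, A.PosSemidef ∧ A.trace = 1 := by
  by_contra! ⟨hB, hA⟩
  set S : Set (Matrix ι ι ℝ) := {X | X.PosSemidef ∧ X.trace = 1}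
  have htr : Continuous fun X : Matrix ι ι ℝ => X.trace := by fun_prop
  have hSc : IsCompact S := (isCompact_psd_trace_le 1).of_isClosed_subset
    (isClosed_psdCone.inter (isClosed_eq htr continuous_const)) fun X hX => ⟨hX.1, hX.2.le⟩
  have hS : Convex ℝ S := by
    rintro X ⟨hX, hX1⟩ Y ⟨hY, hY1⟩ a b ha hb hab
    exact ⟨(hX.smul ha).add (hY.smul hb), by simp [hX1, hY1, hab]⟩
  have : LocallyConvexSpace ℝ (Matrix ι ι ℝ) :=
    inferInstanceAs (LocallyConvexSpace ℝ (ι → ι → ℝ))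
  obtain ⟨f, u, v, hfS, huv, hfL⟩ := geometric_hahn_banach_compact_closed hS hSc L.convex
    L.closed_of_finiteDimensional (Set.disjoint_left.2 fun X hX hXL => hA X hXL hX.1 hX.2)
  have hv : v < 0 := by simpa using hfL 0 L.zero_mem
  have hf0 : ∀ X ∈ L, f X = 0 := fun X hX => by
    by_contra hne
    have := hfL ((v / f X) • X) (L.smul_mem _ hX)
    rw [map_smul, smul_eq_mul, div_mul_cancel₀ _ hne] at this
    exact lt_irrefl _ this
  obtain ⟨C, hC⟩ := exists_eq_trace_mul (-f.toLinearMap)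
  have hCt : ∀ X : Matrix ι ι ℝ, X.IsSymm → (Cᵀ * X).trace = (C * X).trace := fun X hX => by
    rw [← trace_transpose, transpose_mul, transpose_transpose, hX.eq, trace_mul_comm]
  have hpd : (C + Cᵀ).PosDef := by
    refine .of_dotProduct_mulVec_pos
      (by simp [IsHermitian, conjTranspose_eq_transpose_of_trivial, add_comm]) fun x hx => ?_
    have ht : 0 < x ⬝ᵥ x := by simpa using dotProduct_star_self_pos_iff.2 hx
    have hpsd : (vecMulVec x x).PosSemidef := by simpa using posSemidef_vecMulVec_self_star x
    have h1 := hfS ((x ⬝ᵥ x)⁻¹ • vecMulVec x x) ⟨hpsd.smul (inv_nonneg.2 ht.le), by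
      rw [trace_smul, trace_vecMulVec, smul_eq_mul, inv_mul_cancel₀ ht.ne']⟩
    rw [map_smul, smul_eq_mul] at h1
    have h2 : f (vecMulVec x x) < 0 := by
      by_contra! h
      have := mul_nonneg (inv_nonneg.2 ht.le) h
      linarith
    have h3 := hC (vecMulVec x x)
    simp only [LinearMap.neg_apply, ContinuousLinearMap.coe_coe] at h3
    rw [star_trivial, ← trace_mul_vecMulVec, add_mul, trace_add, hCt _ (transpose_vecMulVec _ _)]
    linarith
  obtain ⟨X, hXL, hX⟩ := hB _ hpd
  apply hX
  rw [add_mul, trace_add, hCt X (hL X hXL), ← hC]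
  simp [hf0 X hXL]

theorem congruence_posSemidef {X : Matrix ι ι ℝ} (hX : X.PosSemidef) (Q : Matrix ι ι ℝ) :
    (congruence Q X).PosSemidef := by
  simpa [congruence, conjTranspose_eq_transpose_of_trivial] using hX.conjTranspose_mul_mul_same Q

theorem congruence_posDef [DecidableEq ι] {X Q : Matrix ι ι ℝ} (hX : X.PosDef) (hQ : IsUnit Q) :
    (congruence Q X).PosDef := by
  simpa [congruence, conjTranspose_eq_transpose_of_trivial] using
    hX.conjTranspose_mul_mul_same (mulVec_injective_of_isUnit hQ)

theorem congruence_isSymm {X : Matrix ι ι ℝ} (hX : X.IsSymm) (Q : Matrix ι ι ℝ) :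
    (congruence Q X).IsSymm := by
  simp [congruence, IsSymm, transpose_mul, hX.eq, mul_assoc]

theorem congruence_congruence (Q R X : Matrix ι ι ℝ) :
    congruence R (congruence Q X) = congruence (Q * R) X := by
  simp [congruence, transpose_mul, mul_assoc]

theorem congruence_inv_congruence [DecidableEq ι] {Q : Matrix ι ι ℝ} (hQ : IsUnit Q)
    (X : Matrix ι ι ℝ) : congruence Q⁻¹ (congruence Q X) = X := by
  rw [congruence_congruence, mul_nonsing_inv _ ((isUnit_iff_isUnit_det Q).1 hQ)]
  simp [congruence]

theorem congruence_congruence_inv [DecidableEq ι] {Q : Matrix ι ι ℝ} (hQ : IsUnit Q)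
    (X : Matrix ι ι ℝ) : congruence Q (congruence Q⁻¹ X) = X := by
  rw [congruence_congruence, nonsing_inv_mul _ ((isUnit_iff_isUnit_det Q).1 hQ)]
  simp [congruence]

/-- A positive semidefinite matrix is congruent to a diagonal matrix whose nonzero entries are
positive and have indices in a prescribed set of the right size. -/
theorem exists_congruence_eq_diagonal [DecidableEq ι] {A : Matrix ι ι ℝ} (hA : A.PosSemidef)
    (p : ι → Prop) [DecidablePred p] (hp : Fintype.card {i // p i} = A.rank) :
    ∃ (Q : Matrix ι ι ℝ) (d : ι → ℝ), IsUnit Q ∧ congruence Q A = diagonal d ∧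
      (∀ i, p i → 0 < d i) ∧ ∀ i, ¬ p i → d i = 0 := by
  have hH := hA.isHermitian
  rw [hH.rank_eq_card_non_zero_eigs] at hp
  set e := (Fintype.equivOfCardEq hp).extendSubtype
  set U : Matrix ι ι ℝ := (hH.eigenvectorUnitary : Matrix ι ι ℝ)
  have hUU : star U * U = 1 := Unitary.coe_star_mul_self _
  have hD : star U * A * U = diagonal hH.eigenvalues := by
    have := hH.conjStarAlgAut_star_eigenvectorUnitary
    rw [Unitary.conjStarAlgAut_star_apply] at this
    simpa using this
  refine ⟨U.submatrix id e, hH.eigenvalues ∘ e, ?_, ?_, fun i hi => ?_, fun i hi => ?_⟩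
  · refine IsUnit.of_mul_eq_one (Uᵀ.submatrix e id) (mul_eq_one_comm.1 ?_)
    rw [← submatrix_mul _ _ _ _ _ Function.bijective_id, ← conjTranspose_eq_transpose_of_trivial,
      ← star_eq_conjTranspose, hUU, submatrix_one_equiv]
  · rw [← submatrix_diagonal_equiv, ← hD, star_eq_conjTranspose,
      conjTranspose_eq_transpose_of_trivial]
    rfl
  · exact lt_of_le_of_ne (hA.eigenvalues_nonneg _)
      (Ne.symm ((Fintype.equivOfCardEq hp).extendSubtype_mem i hi))
  · exact not_not.1 ((Fintype.equivOfCardEq hp).extendSubtype_not_mem i hi)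

end Semidefinite

section Distance

variable {ι : Type*} [Fintype ι]

open scoped Matrix.Norms.Frobenius in
theorem abs_apply_le_frobenius_norm (X : Matrix ι ι ℝ) (i j : ι) : |X i j| ≤ ‖X‖ := by
  have h : |X i j| ^ (2 : ℝ) ≤ ∑ i, ∑ j, ‖X i j‖ ^ (2 : ℝ) := by
    refine le_trans ?_ (Finset.single_le_sum (f := fun i => ∑ j, ‖X i j‖ ^ (2 : ℝ))
      (fun i _ => by positivity) (Finset.mem_univ i))
    exact Finset.single_le_sum (f := fun j => ‖X i j‖ ^ (2 : ℝ))
      (fun j _ => by positivity) (Finset.mem_univ j)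
  rw [frobenius_norm_def, ← Real.sqrt_eq_rpow]
  refine Real.le_sqrt_of_sq_le ?_
  exact_mod_cast h

open scoped Matrix.Norms.Frobenius in
theorem setDist_nonneg (C D : Set (Matrix ι ι ℝ)) : 0 ≤ setDist C D := by
  refine Real.sInf_nonneg ?_
  rintro r ⟨x, -, y, -, rfl⟩
  exact norm_nonneg _

open scoped Matrix.Norms.Frobenius in
theorem setDist_le {C D : Set (Matrix ι ι ℝ)} {x y : Matrix ι ι ℝ} (hx : x ∈ C) (hy : y ∈ D) :
    setDist C D ≤ ‖x - y‖ := by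
  refine csInf_le ⟨0, ?_⟩ ⟨x, hx, y, hy, rfl⟩
  rintro r ⟨x, -, y, -, rfl⟩
  exact norm_nonneg _

open scoped Matrix.Norms.Frobenius in
theorem setDist_comm (C D : Set (Matrix ι ι ℝ)) : setDist C D = setDist D C := by
  have h : ∀ C D : Set (Matrix ι ι ℝ), {r | ∃ x ∈ C, ∃ y ∈ D, r = ‖x - y‖} ⊆
      {r | ∃ x ∈ D, ∃ y ∈ C, r = ‖x - y‖} := by
    rintro C D r ⟨x, hx, y, hy, rfl⟩
    exact ⟨y, hy, x, hx, norm_sub_rev x y⟩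
  rw [setDist, setDist, (h C D).antisymm (h D C)]

open scoped Matrix.Norms.Frobenius in
theorem exists_tendsto_sub_of_setDist_eq_zero {C D : Set (Matrix ι ι ℝ)} (hC : C.Nonempty)
    (hD : D.Nonempty) (h : setDist C D = 0) :
    ∃ x y : ℕ → Matrix ι ι ℝ, (∀ k, x k ∈ C) ∧ (∀ k, y k ∈ D) ∧
      Tendsto (fun k => x k - y k) atTop (𝓝 0) := by
  obtain ⟨x₀, hx₀⟩ := hC
  obtain ⟨y₀, hy₀⟩ := hD
  have key : ∀ k : ℕ, ∃ x ∈ C, ∃ y ∈ D, ∀ i j, |(x - y) i j| ≤ 1 / ((k : ℝ) + 1) := fun k => by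
    have hlt : setDist C D < 1 / ((k : ℝ) + 1) := h ▸ Nat.one_div_pos_of_nat
    obtain ⟨r, ⟨x, hx, y, hy, rfl⟩, hr⟩ := exists_lt_of_csInf_lt
      (s := {r | ∃ x ∈ C, ∃ y ∈ D, r = ‖x - y‖}) ⟨_, x₀, hx₀, y₀, hy₀, rfl⟩ hlt
    exact ⟨x, hx, y, hy, fun i j => (abs_apply_le_frobenius_norm _ i j).trans hr.le⟩
  choose x hx y hy hxy using key
  refine ⟨x, y, hx, hy, tendsto_pi_nhds.2 fun i => tendsto_pi_nhds.2 fun j => ?_⟩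
  exact squeeze_zero_norm (fun k => hxy k i j) tendsto_one_div_add_atTop_nhds_zero_nat

end Distance

theorem dotProduct_mulVec_eq_of_injective {ι κ : Type*} [Fintype ι] [Fintype κ] {g : κ → ι}
    (hg : Function.Injective g) (M : Matrix ι ι ℝ) (x : ι → ℝ)
    (h : ∀ i j, i ∉ Set.range g ∨ j ∉ Set.range g → x i * (M i j * x j) = 0) :
    x ⬝ᵥ (M *ᵥ x) = (x ∘ g) ⬝ᵥ (principal g M *ᵥ (x ∘ g)) := by
  simp only [dotProduct, mulVec, Finset.mul_sum, ← Fintype.sum_prod_type']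
  refine (Fintype.sum_of_injective (Prod.map g g) (hg.prodMap hg) _ _ ?_ fun _ => rfl).symm
  rintro ⟨i, j⟩ hij
  refine h i j ?_
  by_contra! ⟨⟨a, ha⟩, ⟨b, hb⟩⟩
  exact hij ⟨(a, b), by simp [ha, hb]⟩

theorem principal_isHermitian {ι κ : Type*} {X : Matrix ι ι ℝ} (hX : X.IsHermitian) (f : κ → ι) :
    (principal f X).IsHermitian :=
  hX.submatrix f

section Tail

variable {n N : ℕ}

theorem card_tail : Fintype.card (Tail n N) = n - N := by
  have h := Fintype.card_subtype_compl fun i : Fin n => i.val < N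
  simp only [not_lt, Fintype.card_fin] at h
  rw [Fintype.card_subtype fun i : Fin n => i.val < N, Fin.card_filter_val_lt] at h
  exact h.trans (by omega)

theorem card_tail_lt {k : ℕ} (h : N + k ≤ n) :
    Fintype.card {i : Tail n N // i.val.val < N + k} = k := by
  have h1 := Fintype.card_subtype_compl fun i : Tail n N => i.val.val < N + k
  have e : {i : Tail n N // ¬ i.val.val < N + k} ≃ Tail n (N + k) :=
    { toFun := fun i => ⟨i.val.val, not_lt.1 i.property⟩
      invFun := fun i => ⟨⟨i.val, by have := i.property; omega⟩, not_lt.2 i.property⟩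
      left_inv := fun _ => rfl
      right_inv := fun _ => rfl }
  have h2 := Fintype.card_subtype_le fun i : Tail n N => i.val.val < N + k
  rw [Fintype.card_congr e, card_tail, card_tail] at h1
  rw [card_tail] at h2
  omega

/-- If the block of `X` below `N + k` is positive definite and the block of `A` below `N` is
`(Â 0; 0 0)` with `Â` positive definite of order `k`, then for some `α > 0` the block of `X + α A`
below `N` is positive definite. -/
theorem exists_posDef_lowerRight_add_smul {N' k : ℕ} (hN' : N' = N + k)
    {X A : Matrix (Fin n) (Fin n) ℝ} (hX : X.IsHermitian) (hX' : (lowerRight N' X).PosDef)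
    (hA : (lowerRight N A).PosSemidef) (hcorner : IsPosDefCorner k (lowerRight N A)) :
    ∃ α : ℝ, 0 < α ∧ (lowerRight N (X + α • A)).PosDef := by
  subst hN'
  simp only [map_add, map_smul]
  refine exists_posDef_add_smul (principal_isHermitian hX _) hA fun x hx h0 => ?_
  have hlow : ∀ i : Tail n N, i.val.val < N + k → x i = 0 := by
    set g : {i : Tail n N // i.val.val < N + k} → Tail n N := fun i => i.val
    rw [dotProduct_mulVec_eq_of_injective (g := g) Subtype.val_injective] at h0
    · by_contra! ⟨i, hi, hxi⟩
      have hne : x ∘ g ≠ 0 := fun h => hxi (congrFun h ⟨i, hi⟩)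
      have := hcorner.1.dotProduct_mulVec_pos hne
      rw [star_trivial] at this
      exact this.ne' h0
    · intro i j hij
      rw [hcorner.2 i j (hij.imp (fun h => not_lt.1 fun hi => h ⟨⟨i, hi⟩, rfl⟩)
        (fun h => not_lt.1 fun hj => h ⟨⟨j, hj⟩, rfl⟩))]
      simp
  set g : Tail n (N + k) → Tail n N := fun i => ⟨i.val, (Nat.le_add_right N k).trans i.property⟩
  have hrange : ∀ i, i ∉ Set.range g → x i = 0 := fun i hi =>
    hlow i (not_le.1 fun h => hi ⟨⟨i.val, h⟩, rfl⟩)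
  have hg : Function.Injective g := fun i j hij => Subtype.ext (congrArg (fun a => a.val) hij)
  rw [dotProduct_mulVec_eq_of_injective hg]
  · have hne : x ∘ g ≠ 0 := fun h => hx <| funext fun i => by
      by_cases hi : i ∈ Set.range g
      · obtain ⟨j, rfl⟩ := hi
        exact congrFun h j
      · exact hrange i hi
    have := hX'.dotProduct_mulVec_pos hne
    rwa [star_trivial] at this
  · rintro i j (h | h) <;> simp [hrange _ h]

theorem sum_mul_extendByOne_tail (Q : Matrix (Tail n N) (Tail n N) ℝ) (f : Fin n → ℝ)
    (j : Tail n N) : ∑ k, f k * extendByOne Q k j = ∑ k : Tail n N, f k * Q k j := by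
  refine (Fintype.sum_of_injective (Subtype.val : Tail n N → Fin n) Subtype.val_injective _ _
    (fun i hi => ?_) fun i => ?_).symm
  · have hlt : ¬ N ≤ i.val := fun h => hi ⟨⟨i, h⟩, rfl⟩
    have hne : i ≠ j.val := fun h => hlt (h ▸ j.property)
    simp [extendByOne, hlt, hne]
  · simp [extendByOne, i.property, j.property]

theorem extendByOne_mul (Q R : Matrix (Tail n N) (Tail n N) ℝ) :
    extendByOne Q * extendByOne R = extendByOne (Q * R) := by
  ext i j
  rw [mul_apply]
  by_cases hj : N ≤ j.val
  · rw [sum_mul_extendByOne_tail R _ ⟨j, hj⟩]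
    by_cases hi : N ≤ i.val
    · have hk : ∀ k : Tail n N, N ≤ k.val.val := fun k => k.property
      simp [extendByOne, hi, hj, hk, mul_apply]
    · have hne : i ≠ j := fun h => hi (h ▸ hj)
      have hne' : ∀ k : Tail n N, i ≠ k.val := fun k h => hi (h ▸ k.property)
      simp [extendByOne, hi, hne, hne']
  · simp [extendByOne, hj]

theorem extendByOne_one : extendByOne (1 : Matrix (Tail n N) (Tail n N) ℝ) = 1 := by
  ext i j
  by_cases h : i = j
  · subst h
    simp [extendByOne]
  · simp [extendByOne, h, one_apply]

theorem isUnit_extendByOne {Q : Matrix (Tail n N) (Tail n N) ℝ} (hQ : IsUnit Q) :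
    IsUnit (extendByOne Q) := by
  refine IsUnit.of_mul_eq_one (extendByOne Q⁻¹) ?_
  rw [extendByOne_mul, mul_nonsing_inv _ ((isUnit_iff_isUnit_det Q).1 hQ), extendByOne_one]

theorem lowerRight_congruence_extendByOne (Q : Matrix (Tail n N) (Tail n N) ℝ)
    (X : Matrix (Fin n) (Fin n) ℝ) :
    lowerRight N (congruence (extendByOne Q) X) = congruence Q (lowerRight N X) := by
  ext i j
  have h1 : lowerRight N (congruence (extendByOne Q) X) i j =
      ∑ k, ((extendByOne Q)ᵀ * X) i k * extendByOne Q k j := rfl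
  have h2 : congruence Q (lowerRight N X) i j =
      ∑ k, (Qᵀ * lowerRight N X) i k * Q k j := rfl
  rw [h1, h2, sum_mul_extendByOne_tail]
  refine Finset.sum_congr rfl fun k _ => ?_
  congr 1
  simp only [mul_apply, transpose_apply]
  have := sum_mul_extendByOne_tail Q (fun l => X l k) i
  simp only [mul_comm (X _ _)] at this
  exact this

theorem lowerRightOfTail_lowerRight {N' : ℕ} (h : N ≤ N') (X : Matrix (Fin n) (Fin n) ℝ) :
    lowerRightOfTail h (lowerRight N X) = lowerRight N' X :=
  rfl

end Tail

section Reachable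

variable {n : ℕ} {L : Submodule ℝ (Matrix (Fin n) (Fin n) ℝ)} {c : Matrix (Fin n) (Fin n) ℝ}
  {s : FPState n}

theorem FPReachable.isUnit_P (hs : FPReachable L c s) : IsUnit s.P := by
  induction hs with
  | init => exact isUnit_one
  | step s hs At hAt hpsd htr Pt hPt hcorner A' hA' hblock ih =>
    exact ih.mul (isUnit_extendByOne hPt)

theorem FPReachable.Lt_eq (hs : FPReachable L c s) :
    s.Lt = (L.map (congruence s.P)).map (lowerRight s.ks.sum) := by
  induction hs with
  | init =>
    have : congruence (1 : Matrix (Fin n) (Fin n) ℝ) = LinearMap.id := by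
      ext X : 1
      simp [congruence]
    simp only [FPState.init, this, Submodule.map_id]
    rfl
  | step s hs At hAt hpsd htr Pt hPt hcorner A' hA' hblock ih =>
    simp only [FPState.next, ih, ← Submodule.map_comp]
    congr 1
    refine LinearMap.ext fun X => ?_
    simp only [LinearMap.comp_apply, ← lowerRight_congruence_extendByOne, congruence_congruence,
      lowerRightOfTail_lowerRight]

theorem FPReachable.mem_map_congruence (hs : FPReachable L c s) :
    ∀ A ∈ s.A, A ∈ L.map (congruence s.P) := by
  induction hs with
  | init => simp [FPState.init]
  | step s hs At hAt hpsd htr Pt hPt hcorner A' hA' hblock ih =>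
    intro A hA
    simp only [FPState.next, List.mem_append, List.mem_map, List.mem_singleton] at hA
    rcases hA with ⟨B, hB, rfl⟩ | rfl
    · obtain ⟨X, hX, rfl⟩ := ih B hB
      exact ⟨X, hX, (congruence_congruence _ _ _).symm⟩
    · exact hA'

theorem rank_pos_of_trace_eq_one {ι : Type*} [Fintype ι] {A : Matrix ι ι ℝ} (h : A.trace = 1) :
    0 < A.rank := by
  classical
  refine Nat.pos_of_ne_zero fun h0 => ?_
  rw [rank, Submodule.finrank_eq_zero, LinearMap.range_eq_bot] at h0
  have hA : A = 0 := by
    ext i j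
    simpa using congrFun (LinearMap.congr_fun h0 (Pi.single j 1)) i
  simp [hA] at h

theorem sum_add_rank_le {N : ℕ} (h : N ≤ n) (A : Matrix (Tail n N) (Tail n N) ℝ) :
    N + A.rank ≤ n := by
  have := A.rank_le_card_width
  rw [card_tail] at this
  omega

theorem FPReachable.sum_ks_le (hs : FPReachable L c s) : s.ks.sum ≤ n := by
  induction hs with
  | init => simp [FPState.init]
  | step s hs At hAt hpsd htr Pt hPt hcorner A' hA' hblock ih =>
    simpa [FPState.next] using sum_add_rank_le ih At

theorem FPReachable.length_A_le (hs : FPReachable L c s) : s.A.length ≤ s.ks.sum := by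
  induction hs with
  | init => simp [FPState.init]
  | step s hs At hAt hpsd htr Pt hPt hcorner A' hA' hblock ih =>
    have := rank_pos_of_trace_eq_one htr
    simp only [FPState.next, List.length_append, List.length_map, List.length_singleton,
      List.sum_append, List.sum_singleton]
    omega

theorem isHermitian_iff_isSymm {ι : Type*} {X : Matrix ι ι ℝ} : X.IsHermitian ↔ X.IsSymm := by
  rw [IsHermitian, IsSymm, conjTranspose_eq_transpose_of_trivial]

/-- A matrix whose block below `k₁ + ⋯ + kₘ` is positive definite becomes positive definite by
adding suitable positive multiples of `A₁, …, Aₘ`. -/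
theorem FPReachable.exists_posDef_add_sum (hL : ∀ X ∈ L, X.IsSymm) (hs : FPReachable L c s) :
    ∀ X : Matrix (Fin n) (Fin n) ℝ, X.IsSymm → (lowerRight s.ks.sum X).PosDef →
      ∃ α : ℕ → ℝ, (∀ i, 0 < α i) ∧
        (X + ∑ i ∈ Finset.range s.A.length, α i • s.A.getD i 0).PosDef := by
  induction hs with
  | init =>
    intro X _ hpd
    refine ⟨fun _ => 1, fun _ => one_pos, ?_⟩
    have : (fun i : Fin n => (⟨i, by simp [FPState.init]⟩ :
        Tail n (FPState.init L c).ks.sum)).Injective :=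
      fun i j hij => congrArg Subtype.val hij
    simp only [FPState.init, List.length_nil, Finset.range_zero, Finset.sum_empty, add_zero]
    exact hpd.submatrix this
  | step s hs At hAt hpsd htr Pt hPt hcorner A' hA' hblock ih =>
    intro X hX hpd
    have hM := isUnit_extendByOne hPt
    have hA's : A'.IsSymm := by
      obtain ⟨Y, hY, rfl⟩ := hA'
      exact congruence_isSymm (hL Y hY) _
    obtain ⟨α', hα', hpd'⟩ := exists_posDef_lowerRight_add_smul (N := s.ks.sum) (k := At.rank)
      (by simp [FPState.next]) (isHermitian_iff_isSymm.2 hX) hpd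
      (hblock ▸ congruence_posSemidef hpsd Pt) (hblock ▸ hcorner)
    set M := extendByOne Pt
    set Y := congruence M⁻¹ (X + α' • A')
    have hYX : congruence M Y = X + α' • A' := congruence_congruence_inv hM _
    have hYpd : (lowerRight s.ks.sum Y).PosDef := by
      rw [← hYX, lowerRight_congruence_extendByOne] at hpd'
      rw [← congruence_inv_congruence hPt (lowerRight s.ks.sum Y)]
      exact congruence_posDef hpd' (isUnit_nonsing_inv_iff.2 hPt)
    obtain ⟨α, hα, hsum⟩ := ih Y (congruence_isSymm (hX.add (hA's.smul α')) _) hYpd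
    refine ⟨fun i => if i = s.A.length then α' else α i, fun i => ?_, ?_⟩
    · dsimp only
      split_ifs
      exacts [hα', hα i]
    · have := congruence_posDef hsum hM
      rw [map_add, hYX, map_sum] at this
      convert this using 1
      simp only [FPState.next, List.length_append, List.length_map, List.length_singleton]
      rw [Finset.sum_range_succ, add_assoc, add_comm (α' • A')]
      congr 2
      · refine Finset.sum_congr rfl fun i hi => ?_
        rw [Finset.mem_range] at hi
        rw [if_neg hi.ne, List.getD_append _ _ _ _ (by simpa using hi), map_smul]
        simp [hi]
        rfl
      · simp

theorem FPReachable.directionSpan_le (hs : FPReachable L c s) : s.directionSpan ≤ L := by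
  refine Submodule.span_le.2 fun D hD => ?_
  obtain ⟨A, hA, rfl⟩ := List.mem_map.1 hD
  obtain ⟨X, hX, rfl⟩ := hs.mem_map_congruence A hA
  rw [congruence_inv_congruence hs.isUnit_P]
  exact hX

theorem FPState.finrank_directionSpan_le (s : FPState n) :
    Module.finrank ℝ s.directionSpan ≤ s.A.length := by
  classical
  have : {D | D ∈ s.directions} = (s.directions.toFinset : Set (Matrix (Fin n) (Fin n) ℝ)) := by
    ext
    simp
  rw [FPState.directionSpan, this]
  refine (finrank_span_finset_le_card _).trans ((List.toFinset_card_le _).trans ?_)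
  simp [FPState.directions]

/-- If the block of `P^T c' P` below `k₁ + ⋯ + kₘ` becomes positive definite by adding a symmetric
matrix `W`, then `c' + ∑ αᵢ Dᵢ`, with suitable `αᵢ > 0`, becomes positive definite by adding
`P⁻ᵀ W P⁻¹`. -/
theorem FPReachable.exists_posDef_add_sum_directions (hL : ∀ X ∈ L, X.IsSymm)
    (hs : FPReachable L c s) {c' W : Matrix (Fin n) (Fin n) ℝ} (hc' : c'.IsSymm) (hW : W.IsSymm)
    (h : (lowerRight s.ks.sum (congruence s.P c' + W)).PosDef) :
    ∃ α : Fin s.directions.length → ℝ, (∀ i, 0 < α i) ∧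
      (c' + ∑ i, α i • s.directions.get i + congruence s.P⁻¹ W).PosDef := by
  obtain ⟨α, hα, hpd⟩ := hs.exists_posDef_add_sum hL _ ((congruence_isSymm hc' _).add hW) h
  refine ⟨fun i => α i, fun i => hα i, ?_⟩
  have := congruence_posDef hpd (isUnit_nonsing_inv_iff.2 hs.isUnit_P)
  rw [map_add, map_add, congruence_inv_congruence hs.isUnit_P, map_sum] at this
  convert this using 1
  rw [add_right_comm]
  congr 1
  have hlen : s.directions.length = s.A.length := by simp [FPState.directions]
  rw [← hlen, Finset.sum_range]
  refine Finset.sum_congr rfl fun i _ => ?_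
  have hi : i.val < s.A.length := hlen ▸ i.isLt
  rw [← List.getD_eq_get _ 0, map_smul]
  simp [FPState.directions, hi]

theorem FPState.sum_directions_mem (s : FPState n) (α : Fin s.directions.length → ℝ) :
    ∑ i, α i • s.directions.get i ∈ s.directionSpan :=
  Submodule.sum_mem _ fun i _ => Submodule.smul_mem _ _
    (Submodule.subset_span (List.get_mem s.directions i))

theorem FPReachable.exists_isFPOutput (hL : ∀ X ∈ L, X.IsSymm) (hs : FPReachable L c s) :
    ∃ t, IsFPOutput L c t := by
  induction hd : n - s.ks.sum using Nat.strong_induction_on generalizing s with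
  | _ d ih =>
    have hsymm : ∀ X ∈ s.Lt, X.IsSymm := by
      rw [hs.Lt_eq]
      rintro _ ⟨_, ⟨X, hX, rfl⟩, rfl⟩
      exact (congruence_isSymm (hL X hX) s.P).submatrix _
    rcases exists_posDef_orthogonal_or_exists_posSemidef hsymm with hB | ⟨At, hAt, hpsd, htr⟩
    · exact ⟨s, hs, hB⟩
    · have hle := sum_add_rank_le hs.sum_ks_le At
      have hpos := rank_pos_of_trace_eq_one htr
      obtain ⟨Pt, d, hPt, hdiag, hd1, hd0⟩ := exists_congruence_eq_diagonal hpsd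
        (fun i => i.val.val < s.ks.sum + At.rank) (card_tail_lt hle)
      obtain ⟨A', hA', hblock⟩ : ∃ A' ∈ L.map (congruence (s.P * extendByOne Pt)),
          lowerRight s.ks.sum A' = congruence Pt At := by
        rw [hs.Lt_eq] at hAt
        obtain ⟨_, ⟨X, hX, rfl⟩, rfl⟩ := hAt
        refine ⟨_, ⟨X, hX, rfl⟩, ?_⟩
        rw [← congruence_congruence, lowerRight_congruence_extendByOne]
      refine ih (n - (s.next Pt At.rank A').ks.sum) ?_
        (.step s hs At hAt hpsd htr Pt hPt ⟨?_, fun i j hij => ?_⟩ A' hA' hblock) rfl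
      · simp only [FPState.next, List.sum_append, List.sum_singleton]
        omega
      · rw [hdiag]
        have := (posDef_diagonal_iff (d := fun i : {i : Tail n s.ks.sum //
          i.val.val < s.ks.sum + At.rank} => d i.val)).2 fun i => hd1 i.val i.property
        convert this using 1
        exact submatrix_diagonal d _ Subtype.val_injective
      · rw [hdiag, diagonal_apply]
        split_ifs with h
        · subst h
          exact hd0 i (not_lt.2 (or_self_iff.1 hij))
        · rfl

theorem isSymm_of_mem_affineSet (hL : ∀ X ∈ L, X.IsSymm) (hc : c.IsSymm)
    {X : Matrix (Fin n) (Fin n) ℝ} (hX : X ∈ affineSet L c) : X.IsSymm := by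
  obtain ⟨l, hl, rfl⟩ := hX
  exact (hL l hl).add hc

theorem affineSet_subset {L' : Submodule ℝ (Matrix (Fin n) (Fin n) ℝ)}
    {c' : Matrix (Fin n) (Fin n) ℝ} (hL' : L' ≤ L) (hc' : c' ∈ affineSet L c) :
    affineSet L' c' ⊆ affineSet L c := by
  obtain ⟨l, hl, rfl⟩ := hc'
  rintro _ ⟨l', hl', rfl⟩
  exact ⟨l' + l, L.add_mem (hL' hl') hl, (add_assoc _ _ _).symm⟩

theorem WeaklyInfeasible.not_posSemidef (h : WeaklyInfeasible L c)
    {X : Matrix (Fin n) (Fin n) ℝ} (hX : X ∈ affineSet L c) : ¬ X.PosSemidef := fun hpsd =>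
  (Set.eq_empty_iff_forall_notMem.1 h.1 X) ⟨hX, hpsd⟩

theorem mem_affineSet_self : c ∈ affineSet L c :=
  ⟨0, L.zero_mem, (zero_add c).symm⟩

/-- The final subproblem of the forward procedure is feasible. -/
theorem IsFPOutput.exists_posSemidef_lowerRight (hs : IsFPOutput L c s)
    (hwi : WeaklyInfeasible L c) :
    ∃ c' ∈ affineSet L c, (lowerRight s.ks.sum (congruence s.P c')).PosSemidef := by
  obtain ⟨x, y, hx, hy, hxy⟩ := exists_tendsto_sub_of_setDist_eq_zero
    ⟨0, PosSemidef.zero⟩ ⟨c, mem_affineSet_self⟩ hwi.2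
  obtain ⟨B, hB, hBL⟩ := hs.2
  set F := lowerRight s.ks.sum ∘ₗ congruence s.P with hF
  have hFLt : s.Lt = L.map F := by rw [hs.1.Lt_eq, ← Submodule.map_comp]
  obtain ⟨z, ⟨w, hw, hz⟩, hpsd⟩ := exists_posSemidef_of_tendsto (c := F c) hB hBL
    (x := fun k => F (x k)) (y := fun k => F (y k))
    (fun k => (congruence_posSemidef (hx k) s.P).submatrix _)
    (fun k => by
      obtain ⟨l, hl, h⟩ := hy k
      exact ⟨F l, hFLt ▸ Submodule.mem_map_of_mem hl, by rw [h, map_add]⟩)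
    (by
      have hc : Continuous F := F.continuous_of_finiteDimensional
      simpa [Function.comp_def] using (hc.tendsto 0).comp hxy)
  rw [hFLt] at hw
  obtain ⟨l, hl, rfl⟩ := hw
  refine ⟨l + c, ⟨l, hl, rfl⟩, ?_⟩
  rw [hz, ← map_add] at hpsd
  exact hpsd

theorem FPReachable.sum_ks_lt (hL : ∀ X ∈ L, X.IsSymm) (hc : c.IsSymm)
    (hwi : WeaklyInfeasible L c) (hs : FPReachable L c s) : s.ks.sum < n := by
  by_contra! hle
  have : IsEmpty (Tail n s.ks.sum) := ⟨fun i => by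
    have := i.val.isLt
    have := i.property
    omega⟩
  obtain ⟨α, -, hpd⟩ := hs.exists_posDef_add_sum_directions hL hc (W := 0) isSymm_zero
    (.of_dotProduct_mulVec_pos (Subsingleton.elim _ _) fun x hx => absurd (Subsingleton.elim _ _) hx)
  rw [map_zero, add_zero] at hpd
  exact hwi.not_posSemidef ⟨_, hs.directionSpan_le (s.sum_directions_mem α), add_comm _ _⟩
    hpd.posSemidef

theorem IsFPOutput.length_A_pos (hwi : WeaklyInfeasible L c) (hs : IsFPOutput L c s) :
    0 < s.A.length := by
  obtain ⟨c', hc', hpsd⟩ := hs.exists_posSemidef_lowerRight hwi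
  obtain ⟨hr, -⟩ := hs
  cases hr with
  | init =>
    have h := hpsd.submatrix fun i : Fin n =>
      (⟨i, Nat.zero_le _⟩ : Tail n (FPState.init L c).ks.sum)
    refine absurd ?_ (hwi.not_posSemidef hc')
    have h1 : congruence (FPState.init L c).P c' = c' := by simp [FPState.init, congruence]
    rw [h1] at h
    exact h
  | step => simp [FPState.next]

open scoped Matrix.Norms.Frobenius in
theorem FPReachable.exists_norm_sub_lt (hL : ∀ X ∈ L, X.IsSymm) (hs : FPReachable L c s)
    {c' : Matrix (Fin n) (Fin n) ℝ} (hc' : c'.IsSymm)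
    (hpsd : (lowerRight s.ks.sum (congruence s.P c')).PosSemidef) {ε : ℝ} (hε : 0 < ε) :
    ∃ α : Fin s.directions.length → ℝ, (∀ i, 0 < α i) ∧
      ∃ Z : Matrix (Fin n) (Fin n) ℝ, Z.PosSemidef ∧
        ‖Z - (c' + ∑ i, α i • s.directions.get i)‖ < ε := by
  set V := congruence s.P⁻¹ 1
  set δ : ℝ := ε / (‖V‖ + 1)
  have hδ : 0 < δ := div_pos hε (by positivity)
  obtain ⟨α, hα, hpd⟩ := hs.exists_posDef_add_sum_directions hL hc' (W := δ • 1)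
    (isSymm_one.smul δ) (by
      rw [map_add]
      refine PosDef.posSemidef_add hpsd ?_
      have h1 : (δ • (1 : Matrix (Fin n) (Fin n) ℝ)).PosDef := PosDef.one.smul hδ
      exact h1.submatrix Subtype.val_injective)
  refine ⟨α, hα, _, hpd.posSemidef, ?_⟩
  rw [add_sub_cancel_left, map_smul, norm_smul, Real.norm_of_nonneg hδ.le, div_mul_eq_mul_div,
    div_lt_iff₀ (by positivity)]
  exact mul_lt_mul_of_pos_left (lt_add_one _) hε

theorem FPReachable.weaklyInfeasible_directionSpan (hL : ∀ X ∈ L, X.IsSymm) (hc : c.IsSymm)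
    (hwi : WeaklyInfeasible L c) (hs : FPReachable L c s) {c' : Matrix (Fin n) (Fin n) ℝ}
    (hc' : c' ∈ affineSet L c)
    (hpsd : (lowerRight s.ks.sum (congruence s.P c')).PosSemidef) :
    WeaklyInfeasible s.directionSpan c' := by
  constructor
  · refine Set.eq_empty_iff_forall_notMem.2 fun X hX => ?_
    exact hwi.not_posSemidef (affineSet_subset hs.directionSpan_le hc' hX.1) hX.2
  · refine le_antisymm (le_of_forall_pos_lt_add fun ε hε => ?_) (setDist_nonneg _ _)
    obtain ⟨α, -, Z, hZ, hlt⟩ :=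
      hs.exists_norm_sub_lt hL (isSymm_of_mem_affineSet hL hc hc') hpsd hε
    rw [zero_add]
    have hmem : c' + ∑ i, α i • s.directions.get i ∈ affineSet s.directionSpan c' :=
      ⟨_, s.sum_directions_mem α, add_comm _ _⟩
    exact (setDist_le (C := psdCone (Fin n)) hZ hmem).trans_lt hlt

end Reachable

end SDFP

theorem theorem2 (n : ℕ) (L : Submodule ℝ (Matrix (Fin n) (Fin n) ℝ))
    (c : Matrix (Fin n) (Fin n) ℝ) (hL : ∀ X ∈ L, X.IsSymm) (hc : c.IsSymm)
    (hwi : SDFP.WeaklyInfeasible L c) :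
    -- an affine subspace of dimension at most `n - 1` that is still weakly infeasible
    (∃ (L' : Submodule ℝ (Matrix (Fin n) (Fin n) ℝ)) (c' : Matrix (Fin n) (Fin n) ℝ),
      SDFP.affineSet L' c' ⊆ SDFP.affineSet L c ∧ Module.finrank ℝ L' ≤ n - 1 ∧
      SDFP.WeaklyInfeasible L' c') ∧
    -- the forward procedure has an output
    (∃ s : SDFP.FPState n, SDFP.IsFPOutput L c s) ∧
    -- every output of the forward procedure provides such a subspace
    (∀ s : SDFP.FPState n, SDFP.IsFPOutput L c s →
      0 < s.A.length ∧ s.A.length ≤ n - 1 ∧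
      (∃ c' ∈ SDFP.affineSet L c,
        (SDFP.lowerRight s.ks.sum (SDFP.congruence s.P c')).PosSemidef) ∧
      ∀ c' ∈ SDFP.affineSet L c,
        (SDFP.lowerRight s.ks.sum (SDFP.congruence s.P c')).PosSemidef →
        SDFP.affineSet s.directionSpan c' ⊆ SDFP.affineSet L c ∧
        Module.finrank ℝ s.directionSpan ≤ n - 1 ∧
        SDFP.WeaklyInfeasible s.directionSpan c' ∧
        ∀ ε > 0, ∃ α : Fin s.directions.length → ℝ, (∀ i, 0 < α i) ∧
          SDFP.setDist {c' + ∑ i, α i • s.directions.get i} (SDFP.psdCone (Fin n)) < ε) := by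
  have houtput := SDFP.FPReachable.exists_isFPOutput hL (SDFP.FPReachable.init (c := c))
  refine ⟨?_, houtput, fun s hs => ?_⟩
  · obtain ⟨s, hs⟩ := houtput
    obtain ⟨c', hc', hpsd⟩ := hs.exists_posSemidef_lowerRight hwi
    have := s.finrank_directionSpan_le
    have := hs.1.length_A_le
    have := hs.1.sum_ks_lt hL hc hwi
    exact ⟨s.directionSpan, c', SDFP.affineSet_subset hs.1.directionSpan_le hc', by omega,
      hs.1.weaklyInfeasible_directionSpan hL hc hwi hc' hpsd⟩
  · have hrank := s.finrank_directionSpan_le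
    have hlen := hs.1.length_A_le
    have hsum := hs.1.sum_ks_lt hL hc hwi
    refine ⟨hs.length_A_pos hwi, by omega, hs.exists_posSemidef_lowerRight hwi,
      fun c' hc' hpsd => ⟨SDFP.affineSet_subset hs.1.directionSpan_le hc', by omega,
        hs.1.weaklyInfeasible_directionSpan hL hc hwi hc' hpsd, fun ε hε => ?_⟩⟩
    obtain ⟨α, hα, Z, hZ, hlt⟩ := hs.1.exists_norm_sub_lt hL
      (SDFP.isSymm_of_mem_affineSet hL hc hc') hpsd hε
    refine ⟨α, hα, ?_⟩
    rw [SDFP.setDist_comm]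
    exact (SDFP.setDist_le (C := SDFP.psdCone (Fin n)) hZ (Set.mem_singleton _)).trans_lt hlt
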